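/- The double tetrahedron is the triangulation of $S^3$ obtained by gluing two disjoint tetrahedra along their corresponding faces; it has vertices $1,2,3,4$ and six edges $ij$. A metric on it is a vector $\ell=(\ell_{ij})\in\mathbb{R}^6$ of edge lengths of a nondegenerate Euclidean tetrahedron. For a metric $\ell$ let $\beta_e$ be the dihedral angle at the edge $e$ and let $\mathrm{Vol}$ be the volume of that tetrahedron, and set $$\mathcal{EHR}(\ell)=\sum_e (2\pi-2\beta_e)\,\ell_e,\qquad \mathcal{LEHR}=\frac{\mathcal{EHR}}{\sum_e \ell_e},\qquad \mathcal{VEHR}=\frac{\mathcal{EHR}}{(2\,\mathrm{Vol})^{1/3}}.$$ The conformal class of a metric $L$ consists of the metrics $\ell(f)$, $f\in\mathbb{R}^4$, with $\ell_{ij}(f)=\exp\left[\tfrac12(f_i+f_j)\right]L_{ij}$; the conformal directions at $\ell(f)$ are the span of the four vectors $\partial\ell/\partial f_i\in\mathbb{R}^6$. Theorem. Let $\mathcal{F}$ be $\mathcal{LEHR}$ or $\mathcal{VEHR}$, let $L$ be a metric, and suppose that $\ell(f)$ is an equal length metric, that is, all $\ell_{ij}(f)$ equal the same $k>0$. Then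 $\mathcal{F}$ is convex within the conformal class at this metric, in the following sense. The function $\mathcal{F}$ is twice continuously differentiable at $\ell(f)$ and $g\mapsto\mathcal{F}(\ell(g))$ is twice continuously differentiable at $g=f$; the conformal directions at $\ell(f)$ lie in the span of the eigenspaces with nonnegative eigenvalues of the full Hessian $\left(\partial^2\mathcal{F}/\partial\ell_e\partial\ell_{e'}\right)$ at $\ell(f)$; the quadratic form of this Hessian is nonnegative on the conformal directions; and the Hessian of $g\mapsto\mathcal{F}(\ell(g))$ at $g=f$ (a $4\times4$ matrix) is positive semidefinite. -/

import Mathlib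

noncomputable section

namespace DoubleTetrahedron

/- The vertices are `Fin 4`; the edges are `Fin 6`, in the order 01, 02, 03, 12, 13, 23, so that the
edge opposite to `e` (in a generating tetrahedron) is `Fin.rev e`. A metric is a vector of edge
lengths `Fin 6 → ℝ`. -/

/-- The smaller vertex of an edge. -/
def edgeFst : Fin 6 → Fin 4 := ![0, 0, 0, 1, 1, 2]

/-- The larger vertex of an edge. -/
def edgeSnd : Fin 6 → Fin 4 := ![1, 2, 3, 2, 3, 3]

/-- The length of the edge between the vertices `i` and `j`, as a symmetric array. -/
def len (l : Fin 6 → ℝ) : Fin 4 → Fin 4 → ℝ :=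
  ![![0, l 0, l 1, l 2],
    ![l 0, 0, l 3, l 4],
    ![l 1, l 3, 0, l 5],
    ![l 2, l 4, l 5, 0]]

/-- The space of metrics: the generating tetrahedron (hence both tetrahedra, which have the same
edges) is realized by a nondegenerate Euclidean tetrahedron with these edge lengths. -/
def met : Set (Fin 6 → ℝ) :=
  {l | ∃ p : Fin 4 → EuclideanSpace ℝ (Fin 3), AffineIndependent ℝ p ∧
    ∀ e, dist (p (edgeFst e)) (p (edgeSnd e)) = l e}

/-- The metric all of whose edge lengths are `k`. -/
def equalLength (k : ℝ) : Fin 6 → ℝ := fun _ => k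

/-- The Cayley-Menger determinant of the generating tetrahedron. -/
def cayleyMenger (l : Fin 6 → ℝ) : ℝ :=
  Matrix.det !![0, 1, 1, 1, 1;
    1, 0, l 0 ^ 2, l 1 ^ 2, l 2 ^ 2;
    1, l 0 ^ 2, 0, l 3 ^ 2, l 4 ^ 2;
    1, l 1 ^ 2, l 3 ^ 2, 0, l 5 ^ 2;
    1, l 2 ^ 2, l 4 ^ 2, l 5 ^ 2, 0]

/-- The volume of the generating tetrahedron. -/
def tetVolume (l : Fin 6 → ℝ) : ℝ := Real.sqrt (cayleyMenger l / 288)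

/-- The angle at the vertex `i` of the face `ijm`, by the Euclidean cosine law. -/
def faceAngle (l : Fin 6 → ℝ) (i j m : Fin 4) : ℝ :=
  Real.arccos ((len l i j ^ 2 + len l i m ^ 2 - len l j m ^ 2) / (2 * len l i j * len l i m))

/-- The dihedral angle at the edge `ij` of the tetrahedron `ijmn`, by the spherical cosine law in
the link of the vertex `i`. -/
def dihedralAngle (l : Fin 6 → ℝ) (i j m n : Fin 4) : ℝ :=
  Real.arccos ((Real.cos (faceAngle l i m n) -
      Real.cos (faceAngle l i j m) * Real.cos (faceAngle l i j n)) /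
    (Real.sin (faceAngle l i j m) * Real.sin (faceAngle l i j n)))

/-- The dihedral angle of the generating tetrahedron at the edge `e`. -/
def edgeDihedral (l : Fin 6 → ℝ) (e : Fin 6) : ℝ :=
  dihedralAngle l (edgeFst e) (edgeSnd e) (edgeFst e.rev) (edgeSnd e.rev)

/-- The edge curvature: each edge lies in two tetrahedra, with equal dihedral angles. -/
def edgeCurvature (l : Fin 6 → ℝ) (e : Fin 6) : ℝ :=
  (2 * Real.pi - 2 * edgeDihedral l e) * l e

/-- The total length. -/
def totalLength (l : Fin 6 → ℝ) : ℝ := ∑ e, l e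

/-- The volume of the double tetrahedron. -/
def volume (l : Fin 6 → ℝ) : ℝ := 2 * tetVolume l

/-- The Einstein-Hilbert-Regge functional. -/
def EHR (l : Fin 6 → ℝ) : ℝ := ∑ e, edgeCurvature l e

/-- The length normalized Einstein-Hilbert-Regge functional. -/
def LEHR (l : Fin 6 → ℝ) : ℝ := EHR l / totalLength l

/-- The volume normalized Einstein-Hilbert-Regge functional. -/
def VEHR (l : Fin 6 → ℝ) : ℝ := EHR l / volume l ^ (1 / 3 : ℝ)

/-- The conformal structure determined by `L`. -/
def conformalMap (L : Fin 6 → ℝ) (f : Fin 4 → ℝ) : Fin 6 → ℝ :=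
  fun e => Real.exp ((1 / 2) * (f (edgeFst e) + f (edgeSnd e))) * L e

/-- The conformal directions at `conformalMap L f`: the span of the velocity vectors `∂/∂f_v`. -/
def conformalDirections (L : Fin 6 → ℝ) (f : Fin 4 → ℝ) : Submodule ℝ (Fin 6 → ℝ) :=
  LinearMap.range (fderiv ℝ (conformalMap L) f : (Fin 4 → ℝ) →ₗ[ℝ] (Fin 6 → ℝ))

/-- The Hessian matrix of second partial derivatives of `F` at `x`. -/
def hessian {n : ℕ} (F : (Fin n → ℝ) → ℝ) (x : Fin n → ℝ) : Matrix (Fin n) (Fin n) ℝ :=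
  Matrix.of fun a b =>
    fderiv ℝ (fun y => fderiv ℝ F y (Pi.single b 1)) x (Pi.single a 1)

/-- The span of the eigenspaces of `A` with nonnegative (real) eigenvalues. -/
def nonnegEigenspan {n : ℕ} (A : Matrix (Fin n) (Fin n) ℝ) : Submodule ℝ (Fin n → ℝ) :=
  ⨆ (c : ℝ) (_ : 0 ≤ c), Module.End.eigenspace (Matrix.toLin' A) c

end DoubleTetrahedron

end

namespace DoubleTetrahedron

open Filter Topology Matrix

/-! At an equal length metric every functional here is symmetric under permutations of the vertices,
so its Hessian has one value `a` on the diagonal, `b` for adjacent edges and `c` for opposite edges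
(`edgePattern a b c`). Its eigenspaces are the constants (eigenvalue `a + 4b + c`), the vectors odd
under exchange of opposite edges (`a - c`), and the even vectors of sum zero (`a + c - 2b`). A
conformal direction has the same sum on each pair of opposite edges (`fderiv_conformalMap_add_rev`),
hence is a constant plus an odd vector, and the third eigenvalue plays no role. Scale invariance
makes the first eigenvalue zero, so everything reduces to `c ≤ a`.

This inequality comes from the Schläfli identity (`schlafli`): the gradient of `EHR` is `2π - 2β_e`,
so its Hessian is read off from first derivatives of the dihedral angles (`hessian_EHR`). Both
normalizations have the form `EHR * (C * P ^ (-r))` with `P` homogeneous of degree `1/r`, namely the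
total length or the Cayley-Menger determinant, and `IsConvexCritical.of_mul_rpow` treats them
together.

By symmetry and scale invariance the metric is also a critical point, so the Hessian along the
conformal class is the pullback of the full Hessian. -/

/-- Sixteen times the squared area of the triangle with side lengths `a`, `b`, `c`. -/
def heron (a b c : ℝ) : ℝ := 4 * a ^ 2 * b ^ 2 - (a ^ 2 + b ^ 2 - c ^ 2) ^ 2

/-- Sixteen times the product of the areas of the faces at the edge `a`, times the cosine of the
dihedral angle at `a`. -/
def cosNum (a b b' c c' d : ℝ) : ℝ :=
  2 * a ^ 2 * (b ^ 2 + b' ^ 2 - d ^ 2) - (a ^ 2 + b ^ 2 - c ^ 2) * (a ^ 2 + b' ^ 2 - c' ^ 2)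

/-- Sixteen times the squared area of the face opposite to a vertex. -/
def faceSq (l : Fin 6 → ℝ) : Fin 4 → ℝ :=
  ![heron (l 3) (l 4) (l 5), heron (l 1) (l 2) (l 5), heron (l 0) (l 2) (l 4),
    heron (l 0) (l 1) (l 3)]

/-- The numerator of the cosine of the dihedral angle at an edge. -/
def dihNum (l : Fin 6 → ℝ) (e : Fin 6) : ℝ :=
  cosNum (len l (edgeFst e) (edgeSnd e)) (len l (edgeFst e) (edgeFst e.rev))
    (len l (edgeFst e) (edgeSnd e.rev)) (len l (edgeSnd e) (edgeFst e.rev))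
    (len l (edgeSnd e) (edgeSnd e.rev)) (len l (edgeFst e.rev) (edgeSnd e.rev))

/-- The nondegeneracy conditions on the edge lengths. -/
def nondeg : Set (Fin 6 → ℝ) :=
  {l | (∀ e, 0 < l e) ∧ (∀ T, 0 < faceSq l T) ∧ 0 < cayleyMenger l}

/-! ### Dihedral angles in terms of polynomials in the edge lengths -/

theorem cos_faceAngle {a b c : ℝ} (ha : 0 < a) (hb : 0 < b) (h : 0 < heron a b c) :
    Real.cos (Real.arccos ((a ^ 2 + b ^ 2 - c ^ 2) / (2 * a * b))) =
      (a ^ 2 + b ^ 2 - c ^ 2) / (2 * a * b) := by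
  have hab : 0 < 2 * a * b := by positivity
  have h1 : |a ^ 2 + b ^ 2 - c ^ 2| < 2 * a * b := by
    apply abs_lt_of_sq_lt_sq _ hab.le
    unfold heron at h
    nlinarith
  rw [abs_lt] at h1
  apply Real.cos_arccos
  · rw [le_div_iff₀ hab]; linarith
  · rw [div_le_iff₀ hab]; linarith

theorem sin_faceAngle {a b c : ℝ} (ha : 0 < a) (hb : 0 < b) :
    Real.sin (Real.arccos ((a ^ 2 + b ^ 2 - c ^ 2) / (2 * a * b))) =
      √(heron a b c) / (2 * a * b) := by
  have hab : 0 < 2 * a * b := by positivity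
  rw [Real.sin_arccos, ← Real.sqrt_sq hab.le, ← Real.sqrt_div' _ (by positivity),
    Real.sqrt_sq hab.le]
  congr 1
  unfold heron
  field_simp
  ring

/-- The face areas enter through equations because the order of the sides of a face, as seen from an
edge, may differ from the order in `faceSq`. -/
theorem dihedralAngle_eq {l : Fin 6 → ℝ} {i j m n : Fin 4} {D D' D'' : ℝ}
    (ha : 0 < len l i j) (hb : 0 < len l i m) (hb' : 0 < len l i n)
    (h1 : heron (len l i j) (len l i m) (len l j m) = D)
    (h2 : heron (len l i j) (len l i n) (len l j n) = D')
    (h3 : heron (len l i m) (len l i n) (len l m n) = D'')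
    (hD : 0 < D) (hD' : 0 < D') (hD'' : 0 < D'') :
    dihedralAngle l i j m n =
      Real.arccos (cosNum (len l i j) (len l i m) (len l i n) (len l j m) (len l j n) (len l m n) /
        (√D * √D')) := by
  subst h1 h2 h3
  have e1 := Real.sqrt_pos.2 hD
  have e2 := Real.sqrt_pos.2 hD'
  unfold dihedralAngle faceAngle
  rw [cos_faceAngle ha hb hD, cos_faceAngle ha hb' hD', cos_faceAngle hb hb' hD'',
    sin_faceAngle ha hb, sin_faceAngle ha hb']
  congr 1
  unfold cosNum
  field_simp

theorem edgeDihedral_eq {l : Fin 6 → ℝ} (hl : l ∈ nondeg) (e : Fin 6) :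
    edgeDihedral l e = Real.arccos (dihNum l e /
      (√(faceSq l (edgeSnd e.rev)) * √(faceSq l (edgeFst e.rev)))) := by
  obtain ⟨hp, hT, -⟩ := hl
  unfold edgeDihedral dihNum
  apply dihedralAngle_eq (D'' := faceSq l (edgeSnd e)) _ _ _ _ _ _ (hT _) (hT _) (hT _)
  all_goals fin_cases e <;>
    first
    | exact hp _
    | (simp [edgeFst, edgeSnd, len, faceSq, heron, Fin.rev]; try ring)

theorem cayleyMenger_eq (l : Fin 6 → ℝ) : cayleyMenger l = 2 *
    (l 0 ^ 2 * l 5 ^ 2 * (l 1 ^ 2 + l 2 ^ 2 + l 3 ^ 2 + l 4 ^ 2 - l 0 ^ 2 - l 5 ^ 2) +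
      l 1 ^ 2 * l 4 ^ 2 * (l 0 ^ 2 + l 2 ^ 2 + l 3 ^ 2 + l 5 ^ 2 - l 1 ^ 2 - l 4 ^ 2) +
      l 2 ^ 2 * l 3 ^ 2 * (l 0 ^ 2 + l 1 ^ 2 + l 4 ^ 2 + l 5 ^ 2 - l 2 ^ 2 - l 3 ^ 2) -
      l 0 ^ 2 * l 1 ^ 2 * l 3 ^ 2 - l 0 ^ 2 * l 2 ^ 2 * l 4 ^ 2 - l 1 ^ 2 * l 2 ^ 2 * l 5 ^ 2 -
      l 3 ^ 2 * l 4 ^ 2 * l 5 ^ 2) := by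
  unfold cayleyMenger
  simp [Matrix.det_succ_row_zero, Fin.sum_univ_succ, Fin.succAbove]
  ring

/-- For an actual tetrahedron this is the square of `Vol = 2 A A' sin β / (3 ℓ)`, where `A` and `A'`
are the areas of the two faces at the edge. It evaluates the sine of the dihedral angle. -/
theorem faceSq_mul_sub_sq (l : Fin 6 → ℝ) (e : Fin 6) :
    faceSq l (edgeSnd e.rev) * faceSq l (edgeFst e.rev) - dihNum l e ^ 2 =
      2 * l e ^ 2 * cayleyMenger l := by
  rw [cayleyMenger_eq]
  fin_cases e <;> simp [edgeFst, edgeSnd, len, faceSq, heron, Fin.rev, dihNum, cosNum] <;> ring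

/-- Each face is the sum of the signed projections of the other three onto its plane: `A = ∑ A' cos
β`, multiplied by `16 A`. -/
theorem dihNum_sum_face (l : Fin 6 → ℝ) :
    dihNum l 3 + dihNum l 4 + dihNum l 5 = faceSq l 0 ∧
    dihNum l 1 + dihNum l 2 + dihNum l 5 = faceSq l 1 ∧
    dihNum l 0 + dihNum l 2 + dihNum l 4 = faceSq l 2 ∧
    dihNum l 0 + dihNum l 1 + dihNum l 3 = faceSq l 3 := by
  refine ⟨?_, ?_, ?_, ?_⟩ <;>
    simp [edgeFst, edgeSnd, len, faceSq, heron, Fin.rev, dihNum, cosNum] <;> ring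

/-! ### Smoothness, openness of nondegeneracy, values at equal lengths -/

theorem contDiff_len (i j : Fin 4) : ContDiff ℝ 2 fun l => len l i j := by
  fin_cases i <;> fin_cases j <;> simp [len] <;> fun_prop

theorem contDiff_dihNum (e : Fin 6) : ContDiff ℝ 2 fun l => dihNum l e := by
  have h := contDiff_len
  unfold dihNum cosNum
  fun_prop

theorem contDiff_faceSq (T : Fin 4) : ContDiff ℝ 2 fun l => faceSq l T := by
  fin_cases T <;> simp [faceSq, heron] <;> fun_prop

theorem contDiff_cayleyMenger : ContDiff ℝ 2 cayleyMenger := by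
  rw [funext cayleyMenger_eq]
  fun_prop

theorem isOpen_nondeg : IsOpen nondeg := by
  have h1 := fun T => (contDiff_faceSq T).continuous
  have h2 := contDiff_cayleyMenger.continuous
  simp only [nondeg, Set.ofPred_and, Set.ofPred_forall]
  exact ((isOpen_iInter_of_finite fun e => isOpen_lt (by fun_prop) (by fun_prop)).inter
    ((isOpen_iInter_of_finite fun T => isOpen_lt (by fun_prop) (h1 T)).inter
      (isOpen_lt (by fun_prop) h2)))

theorem faceSq_equalLength (k : ℝ) (T : Fin 4) : faceSq (equalLength k) T = 3 * k ^ 4 := by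
  fin_cases T <;> simp [faceSq, heron, equalLength] <;> ring

theorem dihNum_equalLength (k : ℝ) (e : Fin 6) : dihNum (equalLength k) e = k ^ 4 := by
  fin_cases e <;> simp [edgeFst, edgeSnd, len, Fin.rev, dihNum, cosNum, equalLength] <;> ring

theorem cayleyMenger_equalLength (k : ℝ) : cayleyMenger (equalLength k) = 4 * k ^ 6 := by
  rw [cayleyMenger_eq]; simp only [equalLength]; ring

theorem equalLength_mem_nondeg {k : ℝ} (hk : 0 < k) : equalLength k ∈ nondeg := by
  refine ⟨fun e => hk, fun T => ?_, ?_⟩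
  · rw [faceSq_equalLength]; positivity
  · rw [cayleyMenger_equalLength]; positivity

/-! ### Differentials of the dihedral angles and the Schläfli identity -/

/-- With `q = N / √(D D')` one has `√(1 - q²) = s / √(D D')`, so the radicals cancel in `-dq / √(1 -
q²)`. -/
theorem hasFDerivAt_arccos_div_sqrt {X : Type*} [NormedAddCommGroup X] [NormedSpace ℝ X]
    {N D D' : X → ℝ} {n d d' : X →L[ℝ] ℝ} {x : X} {s : ℝ}
    (hN : HasFDerivAt N n x) (hD : HasFDerivAt D d x) (hD' : HasFDerivAt D' d' x)
    (h1 : 0 < D x) (h2 : 0 < D' x) (hs : 0 < s) (h : D x * D' x - N x ^ 2 = s ^ 2) :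
    HasFDerivAt (fun y => Real.arccos (N y / (√(D y) * √(D' y))))
      (-s⁻¹ • (n - (N x / (2 * D x)) • d - (N x / (2 * D' x)) • d')) x := by
  have e1 := Real.sqrt_pos.2 h1
  have e2 := Real.sqrt_pos.2 h2
  have q1 := Real.sq_sqrt h1.le
  have q2 := Real.sq_sqrt h2.le
  set r := √(D x) * √(D' x) with hr
  have hr0 : 0 < r := mul_pos e1 e2
  have hr2 : r ^ 2 = D x * D' x := by rw [hr, mul_pow, q1, q2]
  have key : 1 - (N x / r) ^ 2 = (s / r) ^ 2 := by
    field_simp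
    linarith
  have hne : (N x / r) ^ 2 < 1 := by
    have : 0 < (s / r) ^ 2 := by positivity
    linarith
  rw [sq_lt_one_iff_abs_lt_one, abs_lt] at hne
  have hA := Real.hasDerivAt_arccos (x := N x / r) hne.1.ne' hne.2.ne
  rw [key, Real.sqrt_sq (by positivity)] at hA
  have hq := (hN.mul ((hasDerivAt_inv hr0.ne').comp_hasFDerivAt x
    ((hD.sqrt h1.ne').mul (hD'.sqrt h2.ne'))))
  have := HasDerivAt.comp_hasFDerivAt x (h₂ := Real.arccos) hA hq
  refine this.congr_fderiv ?_
  ext v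
  simp only [_root_.smul_apply, _root_.add_apply,
    _root_.sub_apply, smul_eq_mul, Function.comp, Pi.mul_apply]
  rw [← q1, ← q2, hr]
  rw [Real.sqrt_sq e1.le, Real.sqrt_sq e2.le]
  field_simp
  ring

/-- The differential of the dihedral angle at an edge. -/
noncomputable def dihDeriv (x : Fin 6 → ℝ) (e : Fin 6) : (Fin 6 → ℝ) →L[ℝ] ℝ :=
  -(x e * √(2 * cayleyMenger x))⁻¹ • (fderiv ℝ (fun l => dihNum l e) x
    - (dihNum x e / (2 * faceSq x (edgeSnd e.rev))) •
      fderiv ℝ (fun l => faceSq l (edgeSnd e.rev)) x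
    - (dihNum x e / (2 * faceSq x (edgeFst e.rev))) •
      fderiv ℝ (fun l => faceSq l (edgeFst e.rev)) x)

theorem nondeg_eventually {x : Fin 6 → ℝ} (hx : x ∈ nondeg) : ∀ᶠ y in 𝓝 x, y ∈ nondeg :=
  isOpen_nondeg.mem_nhds hx

theorem hasFDerivAt_edgeDihedral {x : Fin 6 → ℝ} (hx : x ∈ nondeg) (e : Fin 6) :
    HasFDerivAt (fun l => edgeDihedral l e) (dihDeriv x e) x := by
  have hN := ((contDiff_dihNum e).differentiable two_ne_zero x).hasFDerivAt
  have hF := fun T => ((contDiff_faceSq T).differentiable two_ne_zero x).hasFDerivAt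
  have hC := hx.2.2
  have := hasFDerivAt_arccos_div_sqrt (s := x e * √(2 * cayleyMenger x)) hN
    (hF (edgeSnd e.rev)) (hF (edgeFst e.rev)) (hx.2.1 _) (hx.2.1 _)
    (mul_pos (hx.1 e) (Real.sqrt_pos.2 (by positivity)))
    (by rw [faceSq_mul_sub_sq, mul_pow, Real.sq_sqrt (by positivity)]; ring)
  refine this.congr_of_eventuallyEq ?_
  filter_upwards [nondeg_eventually hx] with y hy
  exact edgeDihedral_eq hy e

theorem contDiffAt_edgeDihedral {x : Fin 6 → ℝ} (hx : x ∈ nondeg) (e : Fin 6) :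
    ContDiffAt ℝ 2 (fun l => edgeDihedral l e) x := by
  have hC := hx.2.2
  have h1 := hx.2.1 (edgeSnd e.rev)
  have h2 := hx.2.1 (edgeFst e.rev)
  have e1 := Real.sqrt_pos.2 h1
  have e2 := Real.sqrt_pos.2 h2
  have hne : (dihNum x e / (√(faceSq x (edgeSnd e.rev)) * √(faceSq x (edgeFst e.rev)))) ^ 2
      < 1 := by
    rw [div_pow, mul_pow, Real.sq_sqrt h1.le, Real.sq_sqrt h2.le, div_lt_one (by positivity)]
    have := faceSq_mul_sub_sq x e
    have := mul_pos (pow_pos (hx.1 e) 2) hC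
    linarith
  rw [sq_lt_one_iff_abs_lt_one, abs_lt] at hne
  have hq : ContDiffAt ℝ 2 (fun l => dihNum l e /
      (√(faceSq l (edgeSnd e.rev)) * √(faceSq l (edgeFst e.rev)))) x :=
    (contDiff_dihNum e).contDiffAt.div
      (((contDiff_faceSq _).contDiffAt.sqrt h1.ne').mul
        ((contDiff_faceSq _).contDiffAt.sqrt h2.ne')) (by positivity)
  refine ((Real.contDiffAt_arccos hne.1.ne' hne.2.ne).comp x hq).congr_of_eventuallyEq ?_
  filter_upwards [nondeg_eventually hx] with y hy
  exact edgeDihedral_eq hy e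

theorem contDiffAt_EHR {x : Fin 6 → ℝ} (hx : x ∈ nondeg) : ContDiffAt ℝ 2 EHR x := by
  have h := contDiffAt_edgeDihedral hx
  unfold EHR edgeCurvature
  fun_prop

/-- The Schläfli identity. -/
theorem schlafli {x : Fin 6 → ℝ} (hx : x ∈ nondeg) (v : Fin 6 → ℝ) :
    ∑ e, x e * dihDeriv x e v = 0 := by
  have hN := fun e => ((contDiff_dihNum e).differentiable two_ne_zero x).hasFDerivAt
  have hF := fun T => ((contDiff_faceSq T).differentiable two_ne_zero x).hasFDerivAt
  have key {a b c : Fin 6} {T : Fin 4}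
      (h : ∀ l, dihNum l a + dihNum l b + dihNum l c = faceSq l T) :
      fderiv ℝ (fun l => dihNum l a) x v + fderiv ℝ (fun l => dihNum l b) x v +
        fderiv ℝ (fun l => dihNum l c) x v = fderiv ℝ (fun l => faceSq l T) x v := by
    have h1 := (((hN a).add (hN b)).add (hN c)).congr_of_eventuallyEq
      (f₁ := fun l => faceSq l T) (Eventually.of_forall fun l => (h l).symm)
    rw [h1.fderiv]
    rfl
  -- Each edge lies in two faces, so these four identities add up to `2 ∑ dN_e = ∑ dD_T`.
  have k0 := key fun l => (dihNum_sum_face l).1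
  have k1 := key fun l => (dihNum_sum_face l).2.1
  have k2 := key fun l => (dihNum_sum_face l).2.2.1
  have k3 := key fun l => (dihNum_sum_face l).2.2.2
  obtain ⟨s0, s1, s2, s3⟩ := dihNum_sum_face x
  have p0 := (hx.2.1 0).ne'
  have p1 := (hx.2.1 1).ne'
  have p2 := (hx.2.1 2).ne'
  have p3 := (hx.2.1 3).ne'
  set S := √(2 * cayleyMenger x) with hS
  have hterm (e : Fin 6) : x e * dihDeriv x e v = -S⁻¹ * (fderiv ℝ (fun l => dihNum l e) x v
    - (dihNum x e / (2 * faceSq x (edgeSnd e.rev))) *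
      fderiv ℝ (fun l => faceSq l (edgeSnd e.rev)) x v
    - (dihNum x e / (2 * faceSq x (edgeFst e.rev))) *
      fderiv ℝ (fun l => faceSq l (edgeFst e.rev)) x v) := by
    have := (hx.1 e).ne'
    simp only [dihDeriv, _root_.smul_apply, _root_.sub_apply, smul_eq_mul]
    rw [← hS, mul_inv]
    field_simp
  simp only [hterm, ← Finset.mul_sum]
  apply mul_eq_zero_of_right
  simp only [Fin.sum_univ_six]
  have r0 : edgeSnd (Fin.rev 0) = 3 ∧ edgeFst (Fin.rev 0) = 2 := ⟨rfl, rfl⟩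
  have r1 : edgeSnd (Fin.rev 1) = 3 ∧ edgeFst (Fin.rev 1) = 1 := ⟨rfl, rfl⟩
  have r2 : edgeSnd (Fin.rev 2) = 2 ∧ edgeFst (Fin.rev 2) = 1 := ⟨rfl, rfl⟩
  have r3 : edgeSnd (Fin.rev 3) = 3 ∧ edgeFst (Fin.rev 3) = 0 := ⟨rfl, rfl⟩
  have r4 : edgeSnd (Fin.rev 4) = 2 ∧ edgeFst (Fin.rev 4) = 0 := ⟨rfl, rfl⟩
  have r5 : edgeSnd (Fin.rev 5) = 1 ∧ edgeFst (Fin.rev 5) = 0 := ⟨rfl, rfl⟩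
  simp only [r0, r1, r2, r3, r4, r5]
  generalize (fderiv ℝ (fun l => faceSq l 0) x v) = d0 at *
  generalize (fderiv ℝ (fun l => faceSq l 1) x v) = d1 at *
  generalize (fderiv ℝ (fun l => faceSq l 2) x v) = d2 at *
  generalize (fderiv ℝ (fun l => faceSq l 3) x v) = d3 at *
  -- Collecting the coefficient of each `dD_T` gives `1/2`. The sum is therefore `∑ dN_e - (1/2) ∑
  -- dD_T = 0`.
  have t0 : (dihNum x 3 + dihNum x 4 + dihNum x 5) / (2 * faceSq x 0) = 1 / 2 := by
    rw [s0]; field_simp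
  have t1 : (dihNum x 1 + dihNum x 2 + dihNum x 5) / (2 * faceSq x 1) = 1 / 2 := by
    rw [s1]; field_simp
  have t2 : (dihNum x 0 + dihNum x 2 + dihNum x 4) / (2 * faceSq x 2) = 1 / 2 := by
    rw [s2]; field_simp
  have t3 : (dihNum x 0 + dihNum x 1 + dihNum x 3) / (2 * faceSq x 3) = 1 / 2 := by
    rw [s3]; field_simp
  simp only [add_div] at t0 t1 t2 t3
  linear_combination (1 / 2) * (k0 + k1 + k2 + k3) - d0 * t0 - d1 * t1 - d2 * t2 - d3 * t3

/-- The terms that differentiate the angles cancel by the Schläfli identity. -/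
theorem hasFDerivAt_EHR {x : Fin 6 → ℝ} (hx : x ∈ nondeg) :
    HasFDerivAt EHR (∑ e, (2 * Real.pi - 2 * edgeDihedral x e) •
      (ContinuousLinearMap.proj e : (Fin 6 → ℝ) →L[ℝ] ℝ)) x := by
  have h : HasFDerivAt EHR _ x := HasFDerivAt.fun_sum (u := Finset.univ) fun e _ =>
    ((((hasFDerivAt_edgeDihedral hx e).const_mul 2).const_sub (2 * Real.pi)).mul
      (hasFDerivAt_apply e x))
  refine h.congr_fderiv ?_
  ext v
  have hs := schlafli hx v
  simp only [_root_.sum_apply, _root_.add_apply,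
    _root_.smul_apply, _root_.neg_apply, smul_eq_mul,
    ContinuousLinearMap.proj_apply, Finset.sum_add_distrib]
  rw [add_eq_left]
  calc _ = ∑ e, -2 * (x e * dihDeriv x e v) := Finset.sum_congr rfl fun e _ => by ring
    _ = 0 := by rw [← Finset.mul_sum, hs, mul_zero]

/-! ### Hessians of normalized functionals and of compositions -/

section Hessian

variable {n : ℕ} {F G E P : (Fin n → ℝ) → ℝ} {x : Fin n → ℝ}

theorem ContDiffAt.eventually_differentiableAt_two (h : ContDiffAt ℝ 2 F x) :
    ∀ᶠ y in 𝓝 x, DifferentiableAt ℝ F y := by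
  filter_upwards [h.eventually (by simp)] with y hy
  exact hy.differentiableAt two_ne_zero

theorem ContDiffAt.differentiableAt_fderiv (h : ContDiffAt ℝ 2 F x) :
    DifferentiableAt ℝ (fderiv ℝ F) x :=
  (h.fderiv_right (m := 1) (by norm_num)).differentiableAt one_ne_zero

theorem hessian_apply (h : ContDiffAt ℝ 2 F x) (a b : Fin n) :
    hessian F x a b = fderiv ℝ (fderiv ℝ F) x (Pi.single a 1) (Pi.single b 1) := by
  have := (ContDiffAt.differentiableAt_fderiv h).hasFDerivAt.clm_apply
    (hasFDerivAt_const (Pi.single b (1 : ℝ)) x)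
  simp only [hessian, of_apply]
  rw [this.fderiv]
  simp

theorem hessian_congr (h : F =ᶠ[𝓝 x] G) : hessian F x = hessian G x := by
  ext a b
  have h1 : fderiv ℝ F =ᶠ[𝓝 x] fderiv ℝ G := h.fderiv
  have h2 := h1.fun_comp fun l : (Fin n → ℝ) →L[ℝ] ℝ => l (Pi.single b 1)
  exact congrArg (fun l : (Fin n → ℝ) →L[ℝ] ℝ => l (Pi.single a 1))
    (Filter.EventuallyEq.fderiv_eq (𝕜 := ℝ) h2)

theorem hessian_eq_of_eventually {g : (Fin n → ℝ) → ℝ} {b : Fin n} {h : (Fin n → ℝ) →L[ℝ] ℝ}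
    (hF : ∀ᶠ y in 𝓝 x, fderiv ℝ F y (Pi.single b 1) = g y) (hg : HasFDerivAt g h x) (a : Fin n) :
    hessian F x a b = h (Pi.single a 1) := by
  simp only [hessian, of_apply]
  rw [(hg.congr_of_eventuallyEq hF).fderiv]

theorem clm_bilin_eq_dotProduct (B : (Fin n → ℝ) →L[ℝ] (Fin n → ℝ) →L[ℝ] ℝ) (u v : Fin n → ℝ) :
    B u v = u ⬝ᵥ (Matrix.of fun a b => B (Pi.single a 1) (Pi.single b 1)).mulVec v := by
  conv_lhs => rw [pi_eq_sum_univ' u, pi_eq_sum_univ' v]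
  simp only [map_sum, map_smul, _root_.sum_apply, _root_.smul_apply, smul_eq_mul, dotProduct,
    mulVec, of_apply, Finset.mul_sum]
  rw [Finset.sum_comm]
  exact Finset.sum_congr rfl fun i _ => Finset.sum_congr rfl fun j _ => by ring

theorem hasFDerivAt_mul_rpow (C r : ℝ) (hE : DifferentiableAt ℝ E x) (hP : DifferentiableAt ℝ P x)
    (h0 : 0 < P x) :
    HasFDerivAt (fun y => E y * (C * P y ^ (-r)))
      (E x • C • (-r * P x ^ (-r - 1)) • fderiv ℝ P x + (C * P x ^ (-r)) • fderiv ℝ E x) x :=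
  hE.hasFDerivAt.mul ((hP.hasFDerivAt.rpow_const (Or.inl h0.ne')).const_mul C)

theorem contDiffAt_mul_rpow (C r : ℝ) (hE : ContDiffAt ℝ 2 E x) (hP : ContDiffAt ℝ 2 P x)
    (h0 : 0 < P x) : ContDiffAt ℝ 2 (fun y => E y * (C * P y ^ (-r))) x :=
  hE.mul (contDiffAt_const.mul (hP.rpow_const_of_ne h0.ne'))

theorem fderiv_mul_rpow (C r : ℝ) (hE : DifferentiableAt ℝ E x) (hP : DifferentiableAt ℝ P x)
    (h0 : 0 < P x) (v : Fin n → ℝ) :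
    fderiv ℝ (fun y => E y * (C * P y ^ (-r))) x v =
      C * P x ^ (-r) * (fderiv ℝ E x v - E x * (r / P x) * fderiv ℝ P x v) := by
  rw [(hasFDerivAt_mul_rpow C r hE hP h0).fderiv]
  simp only [_root_.smul_apply, _root_.add_apply, smul_eq_mul, Real.rpow_sub_one h0.ne']
  ring

theorem hessian_mul_rpow (C r : ℝ) (hE : ContDiffAt ℝ 2 E x) (hP : ContDiffAt ℝ 2 P x)
    (h0 : 0 < P x) (a b : Fin n) :
    hessian (fun y => E y * (C * P y ^ (-r))) x a b = C * P x ^ (-r) * (hessian E x a b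
      - r / P x * (fderiv ℝ E x (Pi.single b 1) * fderiv ℝ P x (Pi.single a 1)
        + fderiv ℝ E x (Pi.single a 1) * fderiv ℝ P x (Pi.single b 1))
      + E x * (r * (r + 1) / P x ^ 2 * fderiv ℝ P x (Pi.single a 1) * fderiv ℝ P x (Pi.single b 1)
        - r / P x * hessian P x a b)) := by
  have hev : ∀ᶠ y in 𝓝 x, fderiv ℝ (fun y => E y * (C * P y ^ (-r))) y (Pi.single b 1) =
      E y * (C * ((-r * P y ^ (-r - 1)) * fderiv ℝ P y (Pi.single b 1))) +
        (C * P y ^ (-r)) * fderiv ℝ E y (Pi.single b 1) := by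
    filter_upwards [ContDiffAt.eventually_differentiableAt_two hE,
      ContDiffAt.eventually_differentiableAt_two hP,
      hP.continuousAt.eventually (lt_mem_nhds h0)] with y h1 h2 h3
    rw [(hasFDerivAt_mul_rpow C r h1 h2 h3).fderiv]
    rfl
  have dE := (hE.differentiableAt two_ne_zero).hasFDerivAt
  have dP := (hP.differentiableAt two_ne_zero).hasFDerivAt
  have dE' := ((ContDiffAt.differentiableAt_fderiv hE).hasFDerivAt.clm_apply
    (hasFDerivAt_const (Pi.single b (1 : ℝ)) x))
  have dP' := ((ContDiffAt.differentiableAt_fderiv hP).hasFDerivAt.clm_apply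
    (hasFDerivAt_const (Pi.single b (1 : ℝ)) x))
  have := (dE.mul ((((dP.rpow_const (p := -r - 1) (Or.inl h0.ne')).const_mul (-r)).mul
    dP').const_mul C)).add (((dP.rpow_const (p := -r) (Or.inl h0.ne')).const_mul C).mul dE')
  rw [hessian_eq_of_eventually hev this, hessian_apply hE, hessian_apply hP]
  simp only [_root_.smul_apply, _root_.add_apply, smul_eq_mul, Real.rpow_sub_one h0.ne',
    ContinuousLinearMap.flip_apply, ContinuousLinearMap.comp_apply, _root_.zero_apply, map_zero,
    Pi.mul_apply]
  field_simp
  ring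

/-- At a critical point the Hessian of a composition is the pullback of the Hessian. -/
theorem dotProduct_hessian_comp {m : ℕ} {c : (Fin m → ℝ) → Fin n → ℝ} {f : Fin m → ℝ}
    (hF : ContDiffAt ℝ 2 F (c f)) (hc : ContDiff ℝ 2 c) (h0 : fderiv ℝ F (c f) = 0)
    (a b : Fin m) :
    hessian (fun g => F (c g)) f a b = fderiv ℝ c f (Pi.single a 1) ⬝ᵥ
      (hessian F (c f)).mulVec (fderiv ℝ c f (Pi.single b 1)) := by
  have hcd := hc.differentiable two_ne_zero
  have hev : ∀ᶠ g in 𝓝 f, fderiv ℝ (fun g => F (c g)) g (Pi.single b 1) =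
      fderiv ℝ F (c g) (fderiv ℝ c g (Pi.single b 1)) := by
    filter_upwards [hc.continuous.continuousAt.eventually
      (ContDiffAt.eventually_differentiableAt_two hF)] with g hg
    have := hg.hasFDerivAt.comp g (hcd g).hasFDerivAt
    rw [HasFDerivAt.fderiv (f := fun g => F (c g)) this]
    rfl
  have h1 := (ContDiffAt.differentiableAt_fderiv hF).hasFDerivAt.comp f (hcd f).hasFDerivAt
  have h2 : DifferentiableAt ℝ (fun g => fderiv ℝ c g (Pi.single b 1)) f :=
    (((hc.fderiv_right (m := 1) (by norm_num)).differentiable one_ne_zero) f).clm_apply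
      (differentiableAt_const _)
  rw [hessian_eq_of_eventually hev (h1.clm_apply h2.hasFDerivAt)]
  have h3 : hessian F (c f) = Matrix.of fun a b =>
      fderiv ℝ (fderiv ℝ F) (c f) (Pi.single a 1) (Pi.single b 1) := by
    ext a b
    exact hessian_apply hF a b
  rw [h3, ← clm_bilin_eq_dotProduct]
  -- The term with the second derivative of `c` is multiplied by the differential of `F`, which
  -- vanishes.
  simp [h0]

end Hessian

/-! ### Symmetric edge matrices and their eigenvectors -/

/-- The symmetric matrices on edges invariant under permutations of the vertices. -/
def edgePattern (a b c : ℝ) : Matrix (Fin 6) (Fin 6) ℝ :=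
  Matrix.of fun e e' => if e = e' then a else if e' = e.rev then c else b

theorem edgePattern_mulVec (a b c : ℝ) (v : Fin 6 → ℝ) (e : Fin 6) :
    (edgePattern a b c).mulVec v e = a * v e + c * v e.rev +
      b * (∑ e', v e' - v e - v e.rev) := by
  fin_cases e <;> simp [edgePattern, mulVec, dotProduct, Fin.sum_univ_six, Fin.rev] <;> ring

theorem edgePattern_isHermitian (a b c : ℝ) : (edgePattern a b c).IsHermitian := by
  ext i j
  fin_cases i <;> fin_cases j <;> simp [edgePattern, Fin.rev]

section

variable {a b c t : ℝ} {v : Fin 6 → ℝ}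

theorem mem_nonnegEigenspan_edgePattern (h0 : a + 4 * b + c = 0) (h1 : c ≤ a)
    (hv : ∀ e, v e + v e.rev = 2 * t) : v ∈ nonnegEigenspan (edgePattern a b c) := by
  have hs : ∑ e, v e = 6 * t := by
    rw [Fin.sum_univ_six]
    have q0 : v 0 + v 5 = 2 * t := hv 0
    have q1 : v 1 + v 4 = 2 * t := hv 1
    have q2 : v 2 + v 3 = 2 * t := hv 2
    linarith
  have key (d : ℝ) (hd : 0 ≤ d) (w : Fin 6 → ℝ) (hw : (edgePattern a b c).mulVec w = d • w) :
      w ∈ nonnegEigenspan (edgePattern a b c) :=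
    Submodule.mem_iSup_of_mem d (Submodule.mem_iSup_of_mem hd
      (Module.End.mem_eigenspace_iff.2 (by rw [toLin'_apply, hw])))
  have : v = (fun _ => t) + (fun e => v e - t) := by ext e; simp
  rw [this]
  -- The constant part has eigenvalue `a + 4b + c = 0`; the remainder is odd under `Fin.rev` and has
  -- eigenvalue `a - c`.
  refine Submodule.add_mem _ (key 0 le_rfl _ ?_) (key (a - c) (sub_nonneg.2 h1) _ ?_)
  · ext e
    rw [edgePattern_mulVec]
    simp
    linear_combination t * h0
  · ext e
    rw [edgePattern_mulVec]
    have := hv e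
    simp only [Finset.sum_sub_distrib, hs, Pi.smul_apply, smul_eq_mul]
    simp
    linear_combination (c - b) * this

theorem dotProduct_edgePattern_nonneg (h0 : a + 4 * b + c = 0) (h1 : c ≤ a)
    (hv : ∀ e, v e + v e.rev = 2 * t) : 0 ≤ v ⬝ᵥ (edgePattern a b c).mulVec v := by
  have hs : ∑ e, v e = 6 * t := by
    rw [Fin.sum_univ_six]
    have q0 : v 0 + v 5 = 2 * t := hv 0
    have q1 : v 1 + v 4 = 2 * t := hv 1
    have q2 : v 2 + v 3 = 2 * t := hv 2
    linarith
  have hM : ∀ e, (edgePattern a b c).mulVec v e = (a - c) * (v e - t) := fun e => by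
    rw [edgePattern_mulVec, hs]
    linear_combination (c - b) * hv e + t * h0
  have : v ⬝ᵥ (edgePattern a b c).mulVec v = (a - c) * ∑ e, (v e - t) ^ 2 := by
    simp only [dotProduct, hM]
    have h3 : ∑ e, t * (v e - t) = 0 := by
      rw [← Finset.mul_sum, Finset.sum_sub_distrib, hs]; simp
    calc _ = (a - c) * (∑ e, (v e - t) ^ 2 + ∑ e, t * (v e - t)) := by
          rw [← Finset.sum_add_distrib, Finset.mul_sum]
          exact Finset.sum_congr rfl fun e _ => by ring
      _ = _ := by rw [h3, add_zero]
  rw [this]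
  exact mul_nonneg (sub_nonneg.2 h1) (Finset.sum_nonneg fun e _ => sq_nonneg _)

end

/-! ### Derivatives at an equal length metric -/

theorem fderiv_apply_of_hasDerivAt_line {n : ℕ} {F : (Fin n → ℝ) → ℝ} {x v : Fin n → ℝ} {d : ℝ}
    (hF : DifferentiableAt ℝ F x) (h : HasDerivAt (fun t : ℝ => F (x + t • v)) d 0) :
    fderiv ℝ F x v = d := by
  rw [← hF.lineDeriv_eq_fderiv]
  exact h.deriv

theorem hasDerivAt_affine (k p : ℝ) : HasDerivAt (fun t : ℝ => k + t * p) p 0 := by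
  simpa using ((hasDerivAt_id (0 : ℝ)).mul_const p).const_add k

theorem hasDerivAt_heron (k p q r : ℝ) :
    HasDerivAt (fun t : ℝ => heron (k + t * p) (k + t * q) (k + t * r))
      (4 * k ^ 3 * (p + q + r)) 0 := by
  have hp := (hasDerivAt_affine k p).pow 2
  have hq := (hasDerivAt_affine k q).pow 2
  have hr := (hasDerivAt_affine k r).pow 2
  have := ((hp.const_mul 4).mul hq).sub (((hp.add hq).sub hr).pow 2)
  refine this.congr_deriv ?_
  simp
  ring

theorem hasDerivAt_cosNum (k p q q' r r' s : ℝ) :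
    HasDerivAt (fun t : ℝ => cosNum (k + t * p) (k + t * q) (k + t * q') (k + t * r) (k + t * r')
      (k + t * s)) (2 * k ^ 3 * (q + q' + r + r' - 2 * s)) 0 := by
  have hp := (hasDerivAt_affine k p).pow 2
  have hq := (hasDerivAt_affine k q).pow 2
  have hq' := (hasDerivAt_affine k q').pow 2
  have hr := (hasDerivAt_affine k r).pow 2
  have hr' := (hasDerivAt_affine k r').pow 2
  have hs := (hasDerivAt_affine k s).pow 2
  have := ((hp.const_mul 2).mul ((hq.add hq').sub hs)).sub
    (((hp.add hq).sub hr).mul ((hp.add hq').sub hr'))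
  refine this.congr_deriv ?_
  simp
  ring

theorem fderiv_faceSq (k : ℝ) (T : Fin 4) (v : Fin 6 → ℝ) :
    fderiv ℝ (fun l => faceSq l T) (equalLength k) v = 4 * k ^ 3 *
      ![v 3 + v 4 + v 5, v 1 + v 2 + v 5, v 0 + v 2 + v 4, v 0 + v 1 + v 3] T := by
  refine fderiv_apply_of_hasDerivAt_line
    ((contDiff_faceSq T).differentiable two_ne_zero _) ?_
  fin_cases T <;> exact hasDerivAt_heron _ _ _ _

theorem len_equalLength_add (k t : ℝ) (v : Fin 6 → ℝ) {i j : Fin 4} (h : i ≠ j) :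
    len (equalLength k + t • v) i j = k + t * len v i j := by
  fin_cases i <;> fin_cases j <;> first | rfl | exact absurd rfl h

/-- The four edges adjacent to `e` contribute with weight 1, the opposite edge with weight -2 and
`e` itself with weight 0. -/
theorem fderiv_dihNum (k : ℝ) (e : Fin 6) (v : Fin 6 → ℝ) :
    fderiv ℝ (fun l => dihNum l e) (equalLength k) v =
      2 * k ^ 3 * (∑ e', v e' - v e - 3 * v e.rev) := by
  refine fderiv_apply_of_hasDerivAt_line
    ((contDiff_dihNum e).differentiable two_ne_zero _) ?_
  refine HasDerivAt.congr_deriv (f' := 2 * k ^ 3 * (len v (edgeFst e) (edgeFst e.rev) +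
    len v (edgeFst e) (edgeSnd e.rev) + len v (edgeSnd e) (edgeFst e.rev) +
    len v (edgeSnd e) (edgeSnd e.rev) - 2 * len v (edgeFst e.rev) (edgeSnd e.rev))) ?_ ?_
  · have h : edgeFst e ≠ edgeSnd e ∧ edgeFst e ≠ edgeFst e.rev ∧ edgeFst e ≠ edgeSnd e.rev ∧
        edgeSnd e ≠ edgeFst e.rev ∧ edgeSnd e ≠ edgeSnd e.rev ∧ edgeFst e.rev ≠ edgeSnd e.rev := by
      revert e; decide
    obtain ⟨h1, h2, h3, h4, h5, h6⟩ := h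
    simp only [dihNum, len_equalLength_add _ _ _ h1, len_equalLength_add _ _ _ h2,
      len_equalLength_add _ _ _ h3, len_equalLength_add _ _ _ h4, len_equalLength_add _ _ _ h5,
      len_equalLength_add _ _ _ h6]
    exact hasDerivAt_cosNum _ _ _ _ _ _ _
  · rw [Fin.sum_univ_six]
    congr 1
    fin_cases e <;> simp [edgeFst, edgeSnd, len, Fin.rev] <;> ring

/-- The differential of a product over two opposite edges in the Cayley-Menger determinant. -/
def pairTerm (x y : Fin 6 → ℝ) (a b c d e f : Fin 6) : ℝ :=
  (y a * x f + x a * y f) * (x b + x c + x d + x e - x a - x f) +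
    x a * x f * (y b + y c + y d + y e - y a - y f)

/-- The differential of a product over a face in the Cayley-Menger determinant. -/
def faceTerm (x y : Fin 6 → ℝ) (a b c : Fin 6) : ℝ :=
  y a * x b * x c + x a * y b * x c + x a * x b * y c

/-- The differential of the Cayley-Menger determinant in the squared edge lengths. -/
def cayleyMengerDerivSq (x y : Fin 6 → ℝ) : ℝ :=
  2 * (pairTerm x y 0 1 2 3 4 5 + pairTerm x y 1 0 2 3 5 4 + pairTerm x y 2 0 1 4 5 3 -
    faceTerm x y 0 1 3 - faceTerm x y 0 2 4 - faceTerm x y 1 2 5 - faceTerm x y 3 4 5)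

/-- The differential of the Cayley-Menger determinant. -/
def cayleyMengerDeriv (l v : Fin 6 → ℝ) : ℝ :=
  cayleyMengerDerivSq (fun e => l e ^ 2) (fun e => 2 * l e * v e)

theorem hasDerivAt_cayleyMenger (l v : Fin 6 → ℝ) :
    HasDerivAt (fun t : ℝ => cayleyMenger (l + t • v)) (cayleyMengerDeriv l v) 0 := by
  have h (e : Fin 6) := (hasDerivAt_affine (l e) (v e)).pow 2
  have p (a b c d e f : Fin 6) := ((h a).mul (h f)).mul
    ((((((h b).add (h c)).add (h d)).add (h e)).sub (h a)).sub (h f))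
  have q (a b c : Fin 6) := ((h a).mul (h b)).mul (h c)
  have := (((((((p 0 1 2 3 4 5).add (p 1 0 2 3 5 4)).add (p 2 0 1 4 5 3)).sub (q 0 1 3)).sub
    (q 0 2 4)).sub (q 1 2 5)).sub (q 3 4 5)).const_mul 2
  rw [funext fun t : ℝ => cayleyMenger_eq (l + t • v)]
  refine HasDerivAt.congr_deriv (f := fun t => _) this ?_
  simp [cayleyMengerDeriv, cayleyMengerDerivSq, pairTerm, faceTerm]
  ring

theorem hasDerivAt_cayleyMengerDeriv (k : ℝ) (u v : Fin 6 → ℝ) :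
    HasDerivAt (fun t : ℝ => cayleyMengerDeriv (equalLength k + t • u) v)
      (k ^ 4 * (8 * ((∑ e, u e) * ∑ e, v e) - 20 * ∑ e, u e * v e
        - 8 * ∑ e, u e * v e.rev)) 0 := by
  have x (e : Fin 6) := (hasDerivAt_affine k (u e)).pow 2
  have y (e : Fin 6) := ((hasDerivAt_affine k (u e)).const_mul 2).mul_const (v e)
  have p (a b c d e f : Fin 6) :=
    ((((y a).mul (x f)).add ((x a).mul (y f))).mul
      ((((((x b).add (x c)).add (x d)).add (x e)).sub (x a)).sub (x f))).add
    (((x a).mul (x f)).mul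
      ((((((y b).add (y c)).add (y d)).add (y e)).sub (y a)).sub (y f)))
  have q (a b c : Fin 6) := ((((y a).mul (x b)).mul (x c)).add (((x a).mul (y b)).mul (x c))).add
    (((x a).mul (x b)).mul (y c))
  have := (((((((p 0 1 2 3 4 5).add (p 1 0 2 3 5 4)).add (p 2 0 1 4 5 3)).sub (q 0 1 3)).sub
    (q 0 2 4)).sub (q 1 2 5)).sub (q 3 4 5)).const_mul 2
  refine HasDerivAt.congr_deriv this ?_
  simp [Fin.sum_univ_six, Fin.rev]
  ring

theorem fderiv_cayleyMenger (l v : Fin 6 → ℝ) :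
    fderiv ℝ cayleyMenger l v = cayleyMengerDeriv l v :=
  fderiv_apply_of_hasDerivAt_line (contDiff_cayleyMenger.differentiable two_ne_zero _)
    (hasDerivAt_cayleyMenger l v)

theorem fderiv_cayleyMenger_equalLength (k : ℝ) (b : Fin 6) :
    fderiv ℝ cayleyMenger (equalLength k) (Pi.single b 1) = 4 * k ^ 5 := by
  rw [fderiv_cayleyMenger]
  fin_cases b <;>
    simp [equalLength, cayleyMengerDeriv, cayleyMengerDerivSq, pairTerm, faceTerm] <;> ring

theorem hessian_cayleyMenger (k : ℝ) :
    hessian cayleyMenger (equalLength k) = edgePattern (-12 * k ^ 4) (8 * k ^ 4) 0 := by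
  ext a b
  have hd : DifferentiableAt ℝ (fun y => fderiv ℝ cayleyMenger y (Pi.single b 1))
      (equalLength k) :=
    ((contDiff_cayleyMenger.fderiv_right (m := 1) (by norm_num)).differentiable one_ne_zero
      _).clm_apply (differentiableAt_const _)
  simp only [hessian, of_apply]
  rw [fderiv_apply_of_hasDerivAt_line hd (d := k ^ 4 * (8 * ((∑ e, (Pi.single a 1 : Fin 6 → ℝ) e) *
    ∑ e, (Pi.single b 1 : Fin 6 → ℝ) e) -
    20 * ∑ e, (Pi.single a 1 : Fin 6 → ℝ) e * (Pi.single b 1 : Fin 6 → ℝ) e -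
    8 * ∑ e, (Pi.single a 1 : Fin 6 → ℝ) e * (Pi.single b 1 : Fin 6 → ℝ) e.rev))]
  · fin_cases a <;> fin_cases b <;> simp [edgePattern, Fin.sum_univ_six, Fin.rev] <;> ring
  · simp only [fderiv_cayleyMenger]
    exact hasDerivAt_cayleyMengerDeriv k _ _

/-- The common dihedral angle of the regular tetrahedra, in the normalization of `edgeDihedral`. -/
theorem edgeDihedral_equalLength {k : ℝ} (hk : 0 < k) (e : Fin 6) :
    edgeDihedral (equalLength k) e = edgeDihedral (equalLength k) 0 := by
  rw [edgeDihedral_eq (equalLength_mem_nondeg hk), edgeDihedral_eq (equalLength_mem_nondeg hk)]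
  simp only [faceSq_equalLength, dihNum_equalLength]

/-- The entries are `-2 ∂β_b/∂ℓ_a`. The edge `a` lies in two, one or none of the faces at `b`
according as it equals, meets or is opposite to `b`; this yields the ratios `-1 : 1 : -3`. The row
sum `-1 + 4 - 3 = 0` reflects the scale invariance of angles. -/
theorem hessian_EHR {k : ℝ} (hk : 0 < k) : ∃ c > 0,
    hessian EHR (equalLength k) = edgePattern (-c) c (-(3 * c)) := by
  have hx := equalLength_mem_nondeg hk
  -- For adjacent edges the bracket in `dihDeriv` is `2k³ - (1/6) * 4k³ = (4/3)k³`, and the Hessian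
  -- doubles it.
  refine ⟨8 / 3 * k ^ 3 * (k * √(2 * cayleyMenger (equalLength k)))⁻¹, ?_, ?_⟩
  · have := Real.sqrt_pos.2 (mul_pos two_pos hx.2.2)
    positivity
  ext a b
  have hev : ∀ᶠ y in 𝓝 (equalLength k), fderiv ℝ EHR y (Pi.single b 1) =
      2 * Real.pi - 2 * edgeDihedral y b := by
    filter_upwards [nondeg_eventually hx] with y hy
    rw [(hasFDerivAt_EHR hy).fderiv]
    simp [_root_.sum_apply, Pi.single_apply]
  rw [hessian_eq_of_eventually hev
    (((hasFDerivAt_edgeDihedral hx b).const_mul 2).const_sub (2 * Real.pi))]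
  simp only [dihDeriv, _root_.smul_apply, _root_.neg_apply, _root_.sub_apply, smul_eq_mul,
    fderiv_faceSq, fderiv_dihNum, faceSq_equalLength, dihNum_equalLength]
  have hq : k ^ 4 / (2 * (3 * k ^ 4)) = 1 / 6 := by field_simp; norm_num
  rw [hq, show equalLength k b = k from rfl]
  generalize (k * √(2 * cayleyMenger (equalLength k)))⁻¹ = s
  fin_cases a <;> fin_cases b <;>
    simp [edgePattern, Fin.rev, edgeFst, edgeSnd] <;> ring

theorem EHR_equalLength {k : ℝ} (hk : 0 < k) : EHR (equalLength k) =
    6 * k * (2 * Real.pi - 2 * edgeDihedral (equalLength k) 0) := by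
  simp only [EHR, edgeCurvature, edgeDihedral_equalLength hk, Fin.sum_univ_six, equalLength]
  ring

theorem fderiv_EHR_equalLength {k : ℝ} (hk : 0 < k) (b : Fin 6) :
    fderiv ℝ EHR (equalLength k) (Pi.single b 1) =
      2 * Real.pi - 2 * edgeDihedral (equalLength k) 0 := by
  rw [(hasFDerivAt_EHR (equalLength_mem_nondeg hk)).fderiv]
  simp [_root_.sum_apply, Pi.single_apply, edgeDihedral_equalLength hk b]

/-! ### The two normalized functionals -/

/-- The properties of a normalized functional at an equal length metric that give convexity. -/
structure IsConvexCritical (F : (Fin 6 → ℝ) → ℝ) (k : ℝ) : Prop where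
  contDiffAt : ContDiffAt ℝ 2 F (equalLength k)
  fderiv_eq_zero : fderiv ℝ F (equalLength k) = 0
  hessian_eq : ∃ a b c : ℝ, hessian F (equalLength k) = edgePattern a b c ∧
    a + 4 * b + c = 0 ∧ c ≤ a

/-- The conditions `hP1` and `habc` are the Euler identities for `P` and its first partials, for `P`
homogeneous of degree `1/r` with all partials equal. The Hessian of `P` enters with a nonpositive
factor, because `β ≤ π` makes `EHR` nonnegative; hence `a ≤ c` for `P` helps the reverse inequality
for `F`. -/
theorem IsConvexCritical.of_mul_rpow {F P : (Fin 6 → ℝ) → ℝ} {k C r a b c : ℝ} (hk : 0 < k)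
    (hC : 0 < C) (hr : 0 < r) (hP : ContDiffAt ℝ 2 P (equalLength k)) (h0 : 0 < P (equalLength k))
    (hF : F =ᶠ[𝓝 (equalLength k)] fun y => EHR y * (C * P y ^ (-r)))
    (hP1 : ∀ e, fderiv ℝ P (equalLength k) (Pi.single e 1) = P (equalLength k) / (6 * r * k))
    (hP2 : hessian P (equalLength k) = edgePattern a b c)
    (hac : a ≤ c) (habc : a + 4 * b + c = (1 / r - 1) * P (equalLength k) / (6 * r * k ^ 2)) :
    IsConvexCritical F k := by
  have hx := equalLength_mem_nondeg hk
  have hE := contDiffAt_EHR hx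
  obtain ⟨s, hs, hE2⟩ := hessian_EHR hk
  have hθ : 0 ≤ 2 * Real.pi - 2 * edgeDihedral (equalLength k) 0 := by
    have : edgeDihedral (equalLength k) 0 ≤ Real.pi := Real.arccos_le_pi _
    linarith
  have hθ0 := EHR_equalLength hk
  have hE1 := fderiv_EHR_equalLength hk
  generalize 2 * Real.pi - 2 * edgeDihedral (equalLength k) 0 = θ at *
  set p := P (equalLength k) with hp
  have hφ : 0 < C * p ^ (-r) := mul_pos hC (Real.rpow_pos_of_pos h0 _)
  refine ⟨(contDiffAt_mul_rpow C r hE hP h0).congr_of_eventuallyEq hF, ?_,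
    -- The middle term, common to all entries, collects the products of first partials: `θ/(6k) *
    -- (-2 + (1 + 1/r))`. The last one is the Hessian of `P` times `-r * EHR / p`.
    C * p ^ (-r) * (-s + θ / (6 * k) * (1 / r - 1) - 6 * k * θ * r / p * a),
    C * p ^ (-r) * (s + θ / (6 * k) * (1 / r - 1) - 6 * k * θ * r / p * b),
    C * p ^ (-r) * (-(3 * s) + θ / (6 * k) * (1 / r - 1) - 6 * k * θ * r / p * c), ?_, ?_, ?_⟩
  · rw [hF.fderiv_eq]
    refine ContinuousLinearMap.coe_injective (LinearMap.pi_ext' fun e => ?_)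
    ext
    simp only [LinearMap.comp_apply, LinearMap.coe_single, ContinuousLinearMap.coe_coe]
    rw [fderiv_mul_rpow C r (hE.differentiableAt two_ne_zero) (hP.differentiableAt two_ne_zero) h0,
      hE1, hP1, hθ0, ← hp]
    simp
    right
    field_simp
    ring
  · rw [hessian_congr hF]
    ext i j
    rw [hessian_mul_rpow C r hE hP h0, hE1, hE1, hP1, hP1, hP2, hE2, hθ0, ← hp]
    simp only [edgePattern, of_apply]
    split_ifs <;> field_simp <;> ring
  · have : θ / (6 * k) * (1 / r - 1) * 6 - 6 * k * θ * r / p * (a + 4 * b + c) = 0 := by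
      rw [habc]
      field_simp
      ring
    linear_combination C * p ^ (-r) * this
  · apply mul_le_mul_of_nonneg_left _ hφ.le
    have : 6 * k * θ * r / p * a ≤ 6 * k * θ * r / p * c :=
      mul_le_mul_of_nonneg_left hac (by positivity)
    linarith

theorem isConvexCritical_LEHR {k : ℝ} (hk : 0 < k) : IsConvexCritical LEHR k := by
  let S : (Fin 6 → ℝ) →L[ℝ] ℝ := ∑ e, ContinuousLinearMap.proj e
  have hS (l) : S l = totalLength l := by simp [S, totalLength, _root_.sum_apply]
  have h0 : S (equalLength k) = 6 * k := by
    rw [hS]; simp [totalLength, equalLength]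
  have hS1 (y) (e : Fin 6) : fderiv ℝ S y (Pi.single e 1) = 1 := by
    rw [S.fderiv]; simp [S, _root_.sum_apply, Pi.single_apply]
  refine IsConvexCritical.of_mul_rpow (P := S) (C := 1) (r := 1) (a := 0) (b := 0) (c := 0)
    hk one_pos one_pos S.contDiff.contDiffAt (by rw [h0]; positivity)
    (Eventually.of_forall fun y => ?_) (fun e => ?_) ?_ le_rfl (by simp)
  · simp only [LEHR, hS, Real.rpow_neg_one, one_mul, div_eq_mul_inv]
  · rw [hS1, h0]
    field_simp
  · ext i j
    simp only [hessian, hS1]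
    simp [edgePattern]

theorem isConvexCritical_VEHR {k : ℝ} (hk : 0 < k) : IsConvexCritical VEHR k := by
  have hx := equalLength_mem_nondeg hk
  -- The determinant has degree 6, whence `r = 1/6`; the constant `C` comes from `2 Vol = (2/√288) *
  -- cayleyMenger ^ (1/2)`.
  refine IsConvexCritical.of_mul_rpow (P := cayleyMenger) (C := (2 / √288) ^ (-(1 / 3) : ℝ))
    (r := 1 / 6) hk (by positivity) (by norm_num) contDiff_cayleyMenger.contDiffAt hx.2.2
    ?_ (fun e => ?_) (hessian_cayleyMenger k) ?_ ?_
  · filter_upwards [nondeg_eventually hx] with y hy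
    have h := hy.2.2.le
    rw [VEHR, div_eq_mul_inv, ← Real.rpow_neg (by unfold volume tetVolume; positivity)]
    congr 1
    rw [volume, tetVolume, Real.sqrt_div h, mul_div_assoc', mul_comm, ← mul_div_assoc', mul_comm,
      Real.mul_rpow (by positivity) (by positivity), Real.sqrt_eq_rpow (cayleyMenger y),
      ← Real.rpow_mul h]
    norm_num
  · rw [fderiv_cayleyMenger_equalLength, cayleyMenger_equalLength]
    field_simp
  · have : 0 < k ^ 4 := by positivity
    linarith
  · rw [cayleyMenger_equalLength]
    field_simp
    ring

/-! ### Conformal directions and the conformal Hessian -/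

theorem contDiff_conformalMap (L : Fin 6 → ℝ) : ContDiff ℝ 2 (conformalMap L) := by
  unfold conformalMap
  fun_prop

theorem fderiv_conformalMap {L : Fin 6 → ℝ} (f u : Fin 4 → ℝ) (e : Fin 6) :
    fderiv ℝ (conformalMap L) f u e =
      1 / 2 * (u (edgeFst e) + u (edgeSnd e)) * conformalMap L f e := by
  have h := hasFDerivAt_pi'.1
    (((contDiff_conformalMap L).differentiable two_ne_zero) f).hasFDerivAt e
  have h1 : HasFDerivAt (fun g => conformalMap L g e) _ f :=
    ((((hasFDerivAt_apply (𝕜 := ℝ) (edgeFst e) f).add (hasFDerivAt_apply (edgeSnd e) f)).const_mul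
      (1 / 2)).exp).mul_const (L e)
  have := congrArg (fun l : (Fin 4 → ℝ) →L[ℝ] ℝ => l u) (h.unique h1)
  simp only [ContinuousLinearMap.comp_apply, ContinuousLinearMap.proj_apply] at this
  rw [this]
  simp [conformalMap]
  ring

/-- An edge and its opposite together contain each vertex exactly once, so the sum does not depend
on `e`. -/
theorem fderiv_conformalMap_add_rev {L : Fin 6 → ℝ} {f : Fin 4 → ℝ} {k : ℝ}
    (hf : conformalMap L f = equalLength k) (u : Fin 4 → ℝ) (e : Fin 6) :
    fderiv ℝ (conformalMap L) f u e + fderiv ℝ (conformalMap L) f u e.rev =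
      2 * (k / 4 * ∑ i, u i) := by
  simp only [fderiv_conformalMap, hf, equalLength, Fin.sum_univ_four]
  fin_cases e <;> simp [edgeFst, edgeSnd, Fin.rev] <;> ring

theorem IsConvexCritical.posSemidef_hessian_comp {F : (Fin 6 → ℝ) → ℝ} {k : ℝ}
    (hF : IsConvexCritical F k) {L : Fin 6 → ℝ} {f : Fin 4 → ℝ}
    (hf : conformalMap L f = equalLength k) :
    (hessian (fun g => F (conformalMap L g)) f).PosSemidef := by
  obtain ⟨a, b, c, hM, h0, h1⟩ := hF.hessian_eq
  let J : Matrix (Fin 6) (Fin 4) ℝ := LinearMap.toMatrix'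
    (fderiv ℝ (conformalMap L) f : (Fin 4 → ℝ) →ₗ[ℝ] (Fin 6 → ℝ))
  have hJ (u : Fin 4 → ℝ) : J.mulVec u = fderiv ℝ (conformalMap L) f u :=
    LinearMap.toMatrix'_mulVec _ _
  have hH : hessian (fun g => F (conformalMap L g)) f = Jᴴ * edgePattern a b c * J := by
    ext i j
    rw [dotProduct_hessian_comp (by rw [hf]; exact hF.contDiffAt) (contDiff_conformalMap L)
      (by rw [hf]; exact hF.fderiv_eq_zero), hf, hM, ← hJ, ← hJ, Matrix.mul_assoc]
    simp [mul_apply, dotProduct, mulVec, Pi.single_apply]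
  rw [hH]
  refine PosSemidef.of_dotProduct_mulVec_nonneg
    (isHermitian_conjTranspose_mul_mul J (edgePattern_isHermitian a b c)) fun u => ?_
  rw [← mulVec_mulVec, ← mulVec_mulVec, dotProduct_mulVec, ← star_mulVec, hJ, star_trivial]
  exact dotProduct_edgePattern_nonneg h0 h1 (fderiv_conformalMap_add_rev hf u)

end DoubleTetrahedron

theorem mainTheorem4
    (F : (Fin 6 → ℝ) → ℝ) (hF : F = DoubleTetrahedron.LEHR ∨ F = DoubleTetrahedron.VEHR)
    (k : ℝ) (hk : 0 < k)
    (L : Fin 6 → ℝ) (hL : L ∈ DoubleTetrahedron.met) (f : Fin 4 → ℝ)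
    (hf : DoubleTetrahedron.conformalMap L f = DoubleTetrahedron.equalLength k) :
    ContDiffAt ℝ 2 F (DoubleTetrahedron.equalLength k) ∧
    ContDiffAt ℝ 2 (fun g => F (DoubleTetrahedron.conformalMap L g)) f ∧
    DoubleTetrahedron.conformalDirections L f ≤
      DoubleTetrahedron.nonnegEigenspan
        (DoubleTetrahedron.hessian F (DoubleTetrahedron.equalLength k)) ∧
    (∀ v ∈ DoubleTetrahedron.conformalDirections L f,
      0 ≤ v ⬝ᵥ (DoubleTetrahedron.hessian F (DoubleTetrahedron.equalLength k)).mulVec v) ∧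
    (DoubleTetrahedron.hessian
      (fun g => F (DoubleTetrahedron.conformalMap L g)) f).PosSemidef := by
  have h : DoubleTetrahedron.IsConvexCritical F k := by
    rcases hF with rfl | rfl
    · exact DoubleTetrahedron.isConvexCritical_LEHR hk
    · exact DoubleTetrahedron.isConvexCritical_VEHR hk
  obtain ⟨a, b, c, hM, h0, h1⟩ := h.hessian_eq
  refine ⟨h.contDiffAt, ?_, ?_, ?_, h.posSemidef_hessian_comp hf⟩
  · exact ContDiffAt.comp f (by rw [hf]; exact h.contDiffAt)
      (DoubleTetrahedron.contDiff_conformalMap L).contDiffAt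
  · rintro v ⟨u, rfl⟩
    rw [hM]
    exact DoubleTetrahedron.mem_nonnegEigenspan_edgePattern h0 h1
      (DoubleTetrahedron.fderiv_conformalMap_add_rev hf u)
  · rintro v ⟨u, rfl⟩
    rw [hM]
    exact DoubleTetrahedron.dotProduct_edgePattern_nonneg h0 h1
      (DoubleTetrahedron.fderiv_conformalMap_add_rev hf u)
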